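/- Let $r$ be a positive integer and let $(\alpha_k)_{k\in\mathbb N}$, $\mathbb N=\{0,1,2,\dots\}$, be a sequence of nonzero complex numbers. Let $\mathrm U$ be the infinite upper-bidiagonal matrix with $(n,n)$-entry $\alpha_{(r+1)n}$ and $(n,n+1)$-entry $1$ for all $n\in\mathbb N$, and, for $1\le k\le r$, let $\mathrm L_k$ be the infinite lower-bidiagonal matrix with $(n,n)$-entry $1$ and $(n+1,n)$-entry $\alpha_{(r+1)n+k}$ for all $n\in\mathbb N$ (all other entries are $0$). A sequence $(P_n(x))_{n\in\mathbb N}$ in $\mathbb C[x]$ is called $r$-orthogonal with respect to a system $(v_1,\dots,v_r)$ of linear functionals on $\mathbb C[x]$ if every $P_n$ is monic of degree $n$ and, for all $1\le j\le r$ and $k,n\in\mathbb N$, $$\langle v_j,x^kP_n\rangle\neq 0\ \text{ if } n=rk+j-1,\qquad \langle v_j,x^kP_n\rangle=0\ \text{ if } n\ge rk+j.$$ Let $(P_n(x))_{n\in\mathbb N}$ be a sequence in $\mathbb C[x]$ with $P_0=1$. Then $(P_n)$ satisfies the recurrence relation $$x\,[P_n(x)]_{n\in\mathbb N}=\mathrm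 L_1\cdots\mathrm L_r\,\mathrm U\,[P_n(x)]_{n\in\mathbb N}$$ if and only if $(P_n)$ is $r$-orthogonal with respect to a system of linear functionals $(v_1,\dots,v_r)$ with $\langle v_j,1\rangle=1$ for all $1\le j\le r$ for which there exists a sequence $(g_k(t))_{k\in\mathbb N}$ of formal power series over $\mathbb C$ with constant term $1$ such that $$g_0(t)=1,\qquad g_j(t)=\sum_{n=0}^\infty\langle v_j,x^n\rangle t^n\ \ (1\le j\le r),\qquad g_{k+1}(t)-g_k(t)=\alpha_k\,t\,g_{k+r+1}(t)\ \ (k\in\mathbb N).$$ Moreover, the sequence $(g_k)$ and the system $(v_1,\dots,v_r)$ are uniquely determined by $(\alpha_k)$: there is exactly one sequence $(g_k)$ of formal power series with constant term $1$ satisfying $g_0=1$ and $g_{k+1}-g_k=\alpha_k t g_{k+r+1}$ for all $k\in\mathbb N$, and exactly one system $(v_1,\dots,v_r)$ with $\langle v_j,1\rangle=1$ that admits such a sequence $(g_k)$ with $g_j(t)=\sum_{n}\langle v_j,x^n\rangle t^n$ for $1\le j\le r$. -/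

import Mathlib

namespace MOP

/-- An infinite matrix `(a_{m,n})_{m,n ∈ ℕ}` all of whose rows have finitely many nonzero entries:
the entry in row `m` and column `n` is `A m n`. -/
abbrev RowFinMatrix (K : Type*) [Zero K] : Type _ := ℕ → (ℕ →₀ K)

namespace RowFinMatrix

/-- The infinite identity matrix. -/
noncomputable def one (K : Type*) [Field K] : RowFinMatrix K :=
  fun m => Finsupp.single m 1

/-- The product of infinite matrices: `(A B)_{m,n} = ∑_k A_{m,k} B_{k,n}`, a finite sum since the
rows of `A` are finitely supported. -/
noncomputable def mul {K : Type*} [Field K] (A B : RowFinMatrix K) : RowFinMatrix K :=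
  fun m => (A m).sum fun k a => a • B k

/-- The product of an infinite matrix and an infinite column vector of polynomials:
`(A P)_m = ∑_k A_{m,k} P_k`. -/
noncomputable def mulVec {K : Type*} [Field K] (A : RowFinMatrix K) (P : ℕ → Polynomial K) :
    ℕ → Polynomial K :=
  fun m => (A m).sum fun k a => a • P k

end RowFinMatrix

/-- The upper-bidiagonal matrix `U`, with `α_{(r+1)n}` at position `(n, n)` and `1` at position
`(n, n+1)`. -/
noncomputable def upperBidiag {K : Type*} [Field K] (r : ℕ) (α : ℕ → K) : RowFinMatrix K :=
  fun n => Finsupp.single n (α ((r + 1) * n)) + Finsupp.single (n + 1) 1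

/-- The lower-bidiagonal matrix `L_k`, with `1` at position `(n, n)` and `α_{(r+1)n+k}` at position
`(n+1, n)`. -/
noncomputable def lowerBidiag {K : Type*} [Field K] (r : ℕ) (α : ℕ → K) (k : ℕ) : RowFinMatrix K
  | 0 => Finsupp.single 0 1
  | n + 1 => Finsupp.single n (α ((r + 1) * n + k)) + Finsupp.single (n + 1) 1

/-- The product `L_1 L_2 ⋯ L_k` (the identity matrix for `k = 0`). -/
noncomputable def lowerProd {K : Type*} [Field K] (r : ℕ) (α : ℕ → K) : ℕ → RowFinMatrix K
  | 0 => RowFinMatrix.one K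
  | k + 1 => (lowerProd r α k).mul (lowerBidiag r α (k + 1))

/-- The Hessenberg matrix `H = L_1 ⋯ L_r U`. -/
noncomputable def hessenberg {K : Type*} [Field K] (r : ℕ) (α : ℕ → K) : RowFinMatrix K :=
  (lowerProd r α r).mul (upperBidiag r α)

/-- `P` is `r`-orthogonal with respect to the linear functionals `(v_1, …, v_r)`, i.e. it is the
sequence of the type II multiple orthogonal polynomials on the step-line: each `P_n` is monic of
degree `n`, and for all `1 ≤ j ≤ r` and `k ∈ ℕ`, `⟨v_j, x^k P_n⟩` is nonzero if `n = r k + j - 1`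
and zero if `n ≥ r k + j`.  The functionals are indexed from `0` here: `v i` is `v_{i+1}`. -/
structure IsROrthogonal {K : Type*} [Field K] (r : ℕ)
    (v : Fin r → (Polynomial K →ₗ[K] K)) (P : ℕ → Polynomial K) : Prop where
  monic : ∀ n, (P n).Monic
  natDegree_eq : ∀ n, (P n).natDegree = n
  ne_zero : ∀ (i : Fin r) (k n : ℕ), n = r * k + i → v i (Polynomial.X ^ k * P n) ≠ 0
  eq_zero : ∀ (i : Fin r) (k n : ℕ), r * k + i + 1 ≤ n → v i (Polynomial.X ^ k * P n) = 0

/-- The moment generating function `∑_n ⟨u, x^n⟩ t^n` of a linear functional, as a formal power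
series. -/
noncomputable def momentGenFun {K : Type*} [Field K] (u : Polynomial K →ₗ[K] K) : PowerSeries K :=
  PowerSeries.mk fun n => u (Polynomial.X ^ n)

/-- The conditions on `(g_k)` that involve only `α`: each `g_k` has constant term `1`, `g_0 = 1`,
and `g_{k+1} - g_k = α_k t g_{k+r+1}` for all `k`. -/
structure IsSeriesSolution {K : Type*} [Field K] (r : ℕ) (α : ℕ → K)
    (g : ℕ → PowerSeries K) : Prop where
  constantCoeff_eq_one : ∀ k, PowerSeries.constantCoeff (g k) = 1
  zero_eq_one : g 0 = 1
  recurrence : ∀ k, g (k + 1) - g k = PowerSeries.C (α k) * PowerSeries.X * g (k + r + 1)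

/-- `g_j` is the moment generating function of `v_j` for `1 ≤ j ≤ r` (recall that `v i` is
`v_{i+1}`). -/
def GeneratesMoments {K : Type*} [Field K] (r : ℕ) (v : Fin r → (Polynomial K →ₗ[K] K))
    (g : ℕ → PowerSeries K) : Prop :=
  ∀ i : Fin r, g ((i : ℕ) + 1) = momentGenFun (v i)

end MOP

/-! Reading off coefficients, the series recurrence forces a unique solution `g`; let u_k be the
functional with moment series g_k. Telescoping gives u_k(X f) = ∑_{i<k} α_i u_{i+r+1}(f).

Let Q_n^(j) be `orthoPoly r α n j`. It is killed by u_{j+1}, …, u_{j+n}, while u_{j+n+1}(Q_n^(j)) is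
an explicit product of α's, hence nonzero. By triangularity, a polynomial of degree < n killed by
u_{j+1}, …, u_{j+n} is zero (`eq_zero_of_solutionFunctional_eq_zero`). Testing on these functionals
proves `orthoPoly_succ_eq` and `X_mul_orthoPoly`: L_k sends Q^(k) to Q^(k-1), and U sends Q^(0) to X
Q^(r). Hence H Q^(0) = X Q^(0).

Both sides of the equivalence then say P = Q^(0): the recurrence determines P from P_0, and
r-orthogonality makes u_1, …, u_n kill P_n. -/

namespace MOP

open Polynomial

variable {K : Type*} [Field K]

/-! ### The series solution and its functionals -/

/-- The coefficient of `t ^ n` in the `k`-th series solution. -/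
def seriesCoeff (r : ℕ) (α : ℕ → K) : ℕ → ℕ → K
  | 0, _ => 1
  | n + 1, k => ∑ i ∈ Finset.range k, α i * seriesCoeff r α n (i + r + 1)

/-- The series solution determined by `α`. -/
def seriesSolution (r : ℕ) (α : ℕ → K) (k : ℕ) : PowerSeries K :=
  PowerSeries.mk fun n => seriesCoeff r α n k

theorem isSeriesSolution_iff (r : ℕ) (α : ℕ → K) (g : ℕ → PowerSeries K) :
    IsSeriesSolution r α g ↔ g = seriesSolution r α := by
  constructor
  · intro h
    have key : ∀ n k, PowerSeries.coeff n (g k) = seriesCoeff r α n k := by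
      intro n
      induction n with
      | zero =>
        intro k
        simpa [seriesCoeff] using h.constantCoeff_eq_one k
      | succ n ih =>
        intro k
        induction k with
        | zero => simp [h.zero_eq_one, seriesCoeff, PowerSeries.coeff_one]
        | succ k ihk =>
          have e := congrArg (PowerSeries.coeff (n + 1)) (h.recurrence k)
          rw [map_sub, mul_assoc, PowerSeries.coeff_C_mul, PowerSeries.coeff_succ_X_mul, ih,
            ihk] at e
          rw [seriesCoeff, Finset.sum_range_succ, ← e, seriesCoeff]
          ring
    funext k
    ext n
    simp [seriesSolution, key]
  · rintro rfl
    refine ⟨fun k => ?_, ?_, fun k => ?_⟩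
    · rw [← PowerSeries.coeff_zero_eq_constantCoeff_apply]
      simp [seriesSolution, seriesCoeff]
    · ext n
      cases n <;> simp [seriesSolution, seriesCoeff, PowerSeries.coeff_one]
    · ext n
      rw [map_sub, mul_assoc, PowerSeries.coeff_C_mul]
      cases n with
      | zero => simp [seriesSolution, seriesCoeff]
      | succ n =>
        rw [PowerSeries.coeff_succ_X_mul]
        simp [seriesSolution, seriesCoeff, Finset.sum_range_succ]

/-- The linear functional whose moment generating function is the `k`-th series solution. -/
noncomputable def solutionFunctional (r : ℕ) (α : ℕ → K) (k : ℕ) : K[X] →ₗ[K] K :=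
  Polynomial.lsum fun n => LinearMap.toSpanSingleton K K (seriesCoeff r α n k)

theorem solutionFunctional_monomial (r : ℕ) (α : ℕ → K) (k n : ℕ) (a : K) :
    solutionFunctional r α k (monomial n a) = a * seriesCoeff r α n k := by
  simp [solutionFunctional, Polynomial.lsum_apply, Polynomial.sum_monomial_index]

theorem solutionFunctional_X_pow (r : ℕ) (α : ℕ → K) (k n : ℕ) :
    solutionFunctional r α k (X ^ n) = seriesCoeff r α n k := by
  rw [X_pow_eq_monomial, solutionFunctional_monomial, one_mul]

theorem solutionFunctional_one (r : ℕ) (α : ℕ → K) (k : ℕ) :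
    solutionFunctional r α k 1 = 1 := by
  simpa [seriesCoeff] using solutionFunctional_X_pow r α k 0

theorem solutionFunctional_C (r : ℕ) (α : ℕ → K) (k : ℕ) (a : K) :
    solutionFunctional r α k (C a) = a := by
  simpa [seriesCoeff] using solutionFunctional_monomial r α k 0 a

/-- The telescoped series recurrence, transposed to functionals. For k = 0 the sum is empty, so u_0
kills every multiple of X. -/
theorem solutionFunctional_X_mul (r : ℕ) (α : ℕ → K) (k : ℕ) (f : K[X]) :
    solutionFunctional r α k (X * f) =
      ∑ i ∈ Finset.range k, α i * solutionFunctional r α (i + r + 1) f := by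
  induction f using Polynomial.induction_on' with
  | add p q hp hq => simp only [mul_add, map_add, hp, hq, Finset.sum_add_distrib]
  | monomial n a =>
    rw [X_mul_monomial]
    simp only [solutionFunctional_monomial, seriesCoeff, Finset.mul_sum]
    exact Finset.sum_congr rfl fun i _ => by ring

theorem generatesMoments_iff (r : ℕ) (α : ℕ → K) (v : Fin r → (K[X] →ₗ[K] K)) :
    GeneratesMoments r v (seriesSolution r α) ↔
      v = fun i : Fin r => solutionFunctional r α ((i : ℕ) + 1) := by
  constructor
  · intro h
    funext i
    refine Polynomial.lhom_ext' fun n => LinearMap.ext_ring ?_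
    have e := congrArg (PowerSeries.coeff n) (h i)
    simp only [seriesSolution, momentGenFun, PowerSeries.coeff_mk] at e
    simp [solutionFunctional_monomial, e, X_pow_eq_monomial]
  · rintro rfl i
    ext n
    simp [seriesSolution, momentGenFun, solutionFunctional_X_pow]

/-! ### Shifted orthogonal polynomials and their contiguous relations -/

/-- The polynomials `Q_n^{(j)}`: monic of degree `n` and annihilated by the functionals
`j + 1, …, j + n` of the series solution. -/
noncomputable def orthoPoly (r : ℕ) (α : ℕ → K) : ℕ → ℕ → K[X]
  | 0, _ => 1
  | n + 1, j => X * orthoPoly r α n (j + r + 1) -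
      C (solutionFunctional r α (j + 1) (X * orthoPoly r α n (j + r + 1)))

theorem monic_orthoPoly_and_natDegree (r : ℕ) (α : ℕ → K) (n j : ℕ) :
    (orthoPoly r α n j).Monic ∧ (orthoPoly r α n j).natDegree = n := by
  induction n generalizing j with
  | zero => simp [orthoPoly]
  | succ n ih =>
    obtain ⟨hm, hd⟩ := ih (j + r + 1)
    have hm' : (X * orthoPoly r α n (j + r + 1)).Monic := monic_X.mul hm
    have hd' : (X * orthoPoly r α n (j + r + 1)).natDegree = n + 1 := by
      rw [monic_X.natDegree_mul hm, natDegree_X, hd, add_comm]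
    rw [orthoPoly]
    refine ⟨hm'.sub_of_left ?_, by rw [natDegree_sub_C, hd']⟩
    refine lt_of_le_of_lt degree_C_le ?_
    rw [degree_eq_natDegree hm'.ne_zero, hd']
    exact_mod_cast n.succ_pos

theorem monic_orthoPoly (r : ℕ) (α : ℕ → K) (n j : ℕ) : (orthoPoly r α n j).Monic :=
  (monic_orthoPoly_and_natDegree r α n j).1

theorem natDegree_orthoPoly (r : ℕ) (α : ℕ → K) (n j : ℕ) :
    (orthoPoly r α n j).natDegree = n :=
  (monic_orthoPoly_and_natDegree r α n j).2

theorem degree_orthoPoly (r : ℕ) (α : ℕ → K) (n j : ℕ) : (orthoPoly r α n j).degree = n := by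
  rw [degree_eq_natDegree (monic_orthoPoly r α n j).ne_zero, natDegree_orthoPoly]

/-- The constant subtracted in Q_{n+1}^(j) is the value of u_{j+1}, so the first j + 1 terms of the
sum cancel. -/
theorem solutionFunctional_orthoPoly_succ (r : ℕ) (α : ℕ → K) (n j m : ℕ) :
    solutionFunctional r α (j + m + 1) (orthoPoly r α (n + 1) j) =
      ∑ i ∈ Finset.range m, α (j + 1 + i) *
        solutionFunctional r α (j + r + 1 + i + 1) (orthoPoly r α n (j + r + 1)) := by
  rw [orthoPoly, map_sub, solutionFunctional_C, solutionFunctional_X_mul,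
    solutionFunctional_X_mul, show j + m + 1 = j + 1 + m by ring, Finset.sum_range_add,
    add_sub_cancel_left]
  refine Finset.sum_congr rfl fun i _ => ?_
  rw [show j + 1 + i + r + 1 = j + r + 1 + i + 1 by ring]

theorem solutionFunctional_orthoPoly_eq_zero (r : ℕ) (α : ℕ → K) {n m : ℕ} (j : ℕ) (h : m < n) :
    solutionFunctional r α (j + m + 1) (orthoPoly r α n j) = 0 := by
  induction n generalizing j m with
  | zero => omega
  | succ n ih =>
    rw [solutionFunctional_orthoPoly_succ]
    refine Finset.sum_eq_zero fun i hi => ?_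
    rw [Finset.mem_range] at hi
    rw [ih (j + r + 1) (by omega), mul_zero]

theorem solutionFunctional_orthoPoly (r : ℕ) (α : ℕ → K) (n j : ℕ) :
    solutionFunctional r α (j + n + 1) (orthoPoly r α n j) =
      ∏ i ∈ Finset.range n, α (j + n + i * r) := by
  induction n generalizing j with
  | zero => simp [orthoPoly, solutionFunctional_one]
  | succ n ih =>
    rw [solutionFunctional_orthoPoly_succ, Finset.sum_range_succ, Finset.sum_eq_zero, ih,
      Finset.prod_range_succ', zero_add, mul_comm]
    · congr 1
      · exact Finset.prod_congr rfl fun i _ => congrArg α (by ring)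
      · exact congrArg α (by ring)
    · intro i hi
      rw [Finset.mem_range] at hi
      rw [solutionFunctional_orthoPoly_eq_zero r α _ hi, mul_zero]

theorem eq_zero_of_solutionFunctional_eq_zero {r : ℕ} {α : ℕ → K} (hα : ∀ k, α k ≠ 0) (j : ℕ)
    {n : ℕ} {f : K[X]} (hf : f.degree < n)
    (h : ∀ m < n, solutionFunctional r α (j + m + 1) f = 0) : f = 0 := by
  induction n generalizing f with
  | zero => simpa using hf
  | succ n ih =>
    have hfn : f.natDegree ≤ n := natDegree_le_iff_coeff_eq_zero.2 fun m hm =>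
      (degree_lt_iff_coeff_zero f (n + 1)).1 hf m hm
    -- Removing the X^n term with Q_n^(j) keeps the first n values zero; u_{j+n+1} will then kill
    -- the coefficient.
    have e : f - C (f.coeff n) * orthoPoly r α n j = 0 := by
      refine ih ?_ fun m hm => ?_
      · rw [degree_lt_iff_coeff_zero]
        intro m hm
        rcases hm.eq_or_lt with rfl | hm
        · have := monic_orthoPoly r α n j
          rw [Monic, leadingCoeff, natDegree_orthoPoly] at this
          simp [this]
        · rw [coeff_sub, coeff_C_mul, coeff_eq_zero_of_natDegree_lt (hfn.trans_lt hm),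
            coeff_eq_zero_of_natDegree_lt ((natDegree_orthoPoly r α n j).trans_lt hm)]
          simp
      · rw [map_sub, h m (by omega), ← smul_eq_C_mul, map_smul,
          solutionFunctional_orthoPoly_eq_zero r α j hm, smul_zero, sub_zero]
    rw [sub_eq_zero] at e
    have h0 := h n n.lt_succ_self
    rw [e, ← smul_eq_C_mul, map_smul, solutionFunctional_orthoPoly, smul_eq_mul, mul_eq_zero] at h0
    rcases h0 with h0 | h0
    · rw [e, h0, C_0, zero_mul]
    · exact absurd h0 (Finset.prod_ne_zero_iff.2 fun i _ => hα _)

theorem degree_sub_lt_of_monic {p q : K[X]} {n : ℕ} (hp : p.Monic) (hq : q.Monic)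
    (hpn : p.natDegree = n) (hqn : q.natDegree = n) : (p - q).degree < n := by
  have hp' : p.degree = n := by rw [degree_eq_natDegree hp.ne_zero, hpn]
  have hq' : q.degree = n := by rw [degree_eq_natDegree hq.ne_zero, hqn]
  rw [← hp']
  exact degree_sub_lt_left (hp'.trans hq'.symm) hp.ne_zero (by rw [hp.leadingCoeff, hq.leadingCoeff])

/-- Leading terms cancel, so u_{j+2}, …, u_{j+n+2} suffice as tests. Only the last is not trivially
zero, and there the coefficient is the ratio of the two products. -/
theorem orthoPoly_succ_eq {r : ℕ} {α : ℕ → K} (hα : ∀ k, α k ≠ 0) (n j : ℕ) :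
    orthoPoly r α (n + 1) j =
      α ((r + 1) * n + (j + 1)) • orthoPoly r α n (j + 1) + orthoPoly r α (n + 1) (j + 1) := by
  rw [← sub_eq_zero]
  refine eq_zero_of_solutionFunctional_eq_zero (r := r) hα (j + 1) (n := n + 1) ?_ fun m hm => ?_
  · rw [sub_add_eq_sub_sub_swap]
    refine (degree_sub_le _ _).trans_lt (max_lt ?_ ?_)
    · exact degree_sub_lt_of_monic (monic_orthoPoly ..) (monic_orthoPoly ..)
        (natDegree_orthoPoly ..) (natDegree_orthoPoly ..)
    · refine (degree_smul_le _ _).trans_lt ?_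
      rw [degree_orthoPoly]
      exact_mod_cast n.lt_succ_self
  · rw [map_sub, map_add, map_smul, solutionFunctional_orthoPoly_eq_zero r α (j + 1) hm, add_zero,
      smul_eq_mul]
    rcases (Nat.lt_succ_iff.1 hm).eq_or_lt with rfl | hm'
    · rw [solutionFunctional_orthoPoly, show j + 1 + m + 1 = j + (m + 1) + 1 by ring,
        solutionFunctional_orthoPoly, Finset.prod_range_succ, sub_eq_zero, mul_comm]
      congr 1
      · exact congrArg α (by ring)
      · exact Finset.prod_congr rfl fun i _ => congrArg α (by ring)
    · rw [solutionFunctional_orthoPoly_eq_zero r α (j + 1) hm',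
        show j + 1 + m + 1 = j + (m + 1) + 1 by ring,
        solutionFunctional_orthoPoly_eq_zero r α j (by omega), mul_zero, sub_zero]

theorem X_mul_orthoPoly {r : ℕ} {α : ℕ → K} (hα : ∀ k, α k ≠ 0) (n : ℕ) :
    X * orthoPoly r α n r =
      α ((r + 1) * n) • orthoPoly r α n 0 + orthoPoly r α (n + 1) 0 := by
  rw [← sub_eq_zero]
  refine eq_zero_of_solutionFunctional_eq_zero (r := r) hα 0 (n := n + 1) ?_ fun m hm => ?_
  · rw [sub_add_eq_sub_sub_swap]
    refine (degree_sub_le _ _).trans_lt (max_lt ?_ ?_)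
    · refine degree_sub_lt_of_monic (monic_X.mul (monic_orthoPoly ..)) (monic_orthoPoly ..)
        ?_ (natDegree_orthoPoly ..)
      rw [monic_X.natDegree_mul (monic_orthoPoly ..), natDegree_X, natDegree_orthoPoly, add_comm]
    · refine (degree_smul_le _ _).trans_lt ?_
      rw [degree_orthoPoly]
      exact_mod_cast n.lt_succ_self
  · have hz : ∀ i < n, α i * solutionFunctional r α (i + r + 1) (orthoPoly r α n r) = 0 := by
      intro i hi
      rw [add_comm i r, solutionFunctional_orthoPoly_eq_zero r α r hi, mul_zero]
    rw [map_sub, map_add, map_smul, solutionFunctional_orthoPoly_eq_zero r α 0 hm, add_zero,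
      smul_eq_mul, zero_add, solutionFunctional_X_mul]
    rcases (Nat.lt_succ_iff.1 hm).eq_or_lt with rfl | hm'
    · have h0 := solutionFunctional_orthoPoly r α m 0
      rw [zero_add] at h0
      rw [Finset.sum_range_succ, Finset.sum_eq_zero fun i hi => hz i (Finset.mem_range.1 hi), h0,
        zero_add, add_comm m r, solutionFunctional_orthoPoly, sub_eq_zero,
        show (r + 1) * m = m + m * r by ring, mul_comm (α (m + m * r)),
        ← Finset.prod_range_succ (fun i => α (m + i * r)), Finset.prod_range_succ', mul_comm]
      congr 1
      · exact Finset.prod_congr rfl fun i _ => congrArg α (by ring)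
      · exact congrArg α (by ring)
    · have h0 := solutionFunctional_orthoPoly_eq_zero r α 0 hm'
      rw [zero_add] at h0
      rw [h0, mul_zero, sub_zero]
      exact Finset.sum_eq_zero fun i hi => hz i (by rw [Finset.mem_range] at hi; omega)

/-! ### Action of the bidiagonal matrices -/

namespace RowFinMatrix

theorem mulVec_eq_linearCombination (A : RowFinMatrix K) (P : ℕ → K[X]) (n : ℕ) :
    A.mulVec P n = Finsupp.linearCombination K P (A n) :=
  rfl

theorem mulVec_one (P : ℕ → K[X]) : (one K).mulVec P = P := by
  funext n
  simp [mulVec, one]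

theorem mulVec_mul (A B : RowFinMatrix K) (P : ℕ → K[X]) :
    (A.mul B).mulVec P = A.mulVec (B.mulVec P) := by
  funext n
  simp only [mulVec_eq_linearCombination, mul, map_finsuppSum, map_smul]
  rfl

theorem mulVec_X_mul (A : RowFinMatrix K) (P : ℕ → K[X]) (n : ℕ) :
    A.mulVec (fun m => X * P m) n = X * A.mulVec P n := by
  simp only [mulVec, Finsupp.sum, Finset.mul_sum, mul_smul_comm]

theorem mulVec_sub (A : RowFinMatrix K) (P Q : ℕ → K[X]) (n : ℕ) :
    A.mulVec (fun m => P m - Q m) n = A.mulVec P n - A.mulVec Q n := by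
  simp only [mulVec, Finsupp.sum, smul_sub, Finset.sum_sub_distrib]

end RowFinMatrix

theorem upperBidiag_mulVec (r : ℕ) (α : ℕ → K) (P : ℕ → K[X]) (n : ℕ) :
    (upperBidiag r α).mulVec P n = α ((r + 1) * n) • P n + P (n + 1) := by
  simp [RowFinMatrix.mulVec_eq_linearCombination, upperBidiag]

theorem lowerBidiag_mulVec_zero (r : ℕ) (α : ℕ → K) (k : ℕ) (P : ℕ → K[X]) :
    (lowerBidiag r α k).mulVec P 0 = P 0 := by
  simp [RowFinMatrix.mulVec, lowerBidiag]

theorem lowerBidiag_mulVec_succ (r : ℕ) (α : ℕ → K) (k : ℕ) (P : ℕ → K[X]) (n : ℕ) :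
    (lowerBidiag r α k).mulVec P (n + 1) = α ((r + 1) * n + k) • P n + P (n + 1) := by
  simp [RowFinMatrix.mulVec_eq_linearCombination, lowerBidiag]

/-- The product is unit lower triangular. -/
theorem lowerProd_mulVec_of_eq_zero (r : ℕ) (α : ℕ → K) (k : ℕ) {P : ℕ → K[X]} {n : ℕ}
    (h : ∀ m < n, P m = 0) : (lowerProd r α k).mulVec P n = P n := by
  induction k generalizing P with
  | zero => rw [lowerProd, RowFinMatrix.mulVec_one]
  | succ k ih =>
    have hB : ∀ m ≤ n, (lowerBidiag r α (k + 1)).mulVec P m = P m := by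
      intro m hm
      cases m with
      | zero => rw [lowerBidiag_mulVec_zero]
      | succ m => rw [lowerBidiag_mulVec_succ, h m (by omega), smul_zero, zero_add]
    rw [lowerProd, RowFinMatrix.mulVec_mul, ih fun m hm => (hB m hm.le).trans (h m hm),
      hB n le_rfl]

theorem lowerProd_mulVec_orthoPoly {r : ℕ} {α : ℕ → K} (hα : ∀ k, α k ≠ 0) (k : ℕ) :
    (lowerProd r α k).mulVec (fun n => orthoPoly r α n k) = fun n => orthoPoly r α n 0 := by
  induction k with
  | zero => rw [lowerProd, RowFinMatrix.mulVec_one]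
  | succ k ih =>
    rw [lowerProd, RowFinMatrix.mulVec_mul, ← ih]
    congr 1
    funext n
    cases n with
    | zero => simp [lowerBidiag_mulVec_zero, orthoPoly]
    | succ n => rw [lowerBidiag_mulVec_succ, ← orthoPoly_succ_eq hα]

theorem hessenberg_mulVec_orthoPoly {r : ℕ} {α : ℕ → K} (hα : ∀ k, α k ≠ 0) (n : ℕ) :
    (hessenberg r α).mulVec (fun n => orthoPoly r α n 0) n = X * orthoPoly r α n 0 := by
  have hU : (upperBidiag r α).mulVec (fun n => orthoPoly r α n 0) =
      fun n => X * orthoPoly r α n r := by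
    funext n
    rw [upperBidiag_mulVec, X_mul_orthoPoly hα]
  rw [hessenberg, RowFinMatrix.mulVec_mul, hU, RowFinMatrix.mulVec_X_mul,
    lowerProd_mulVec_orthoPoly hα]

/-- The superdiagonal of H is 1, so row n expresses d (n + 1) through earlier terms. -/
theorem eq_zero_of_hessenberg_mulVec {r : ℕ} {α : ℕ → K} {d : ℕ → K[X]} (h0 : d 0 = 0)
    (h : ∀ n, X * d n = (hessenberg r α).mulVec d n) (n : ℕ) : d n = 0 := by
  induction n using Nat.strong_induction_on with
  | _ n ih =>
    cases n with
    | zero => exact h0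
    | succ n =>
      have hU : ∀ m < n, (upperBidiag r α).mulVec d m = 0 := by
        intro m hm
        rw [upperBidiag_mulVec, ih m (by omega), ih (m + 1) (by omega), smul_zero, add_zero]
      have e := h n
      rw [hessenberg, RowFinMatrix.mulVec_mul, lowerProd_mulVec_of_eq_zero r α r hU,
        upperBidiag_mulVec, ih n n.lt_succ_self, mul_zero, smul_zero, zero_add] at e
      exact e.symm

theorem hessenberg_recurrence_iff {r : ℕ} {α : ℕ → K} (hα : ∀ k, α k ≠ 0) {P : ℕ → K[X]}
    (hP : P 0 = 1) :
    (∀ n, X * P n = (hessenberg r α).mulVec P n) ↔ P = fun n => orthoPoly r α n 0 := by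
  constructor
  · intro h
    funext n
    refine sub_eq_zero.1 (eq_zero_of_hessenberg_mulVec (r := r) (α := α)
      (d := fun n => P n - orthoPoly r α n 0) ?_ (fun n => ?_) n)
    · simp [hP, orthoPoly]
    · rw [RowFinMatrix.mulVec_sub, ← h, hessenberg_mulVec_orthoPoly hα, mul_sub]
  · rintro rfl n
    exact (hessenberg_mulVec_orthoPoly hα n).symm

/-! ### r-orthogonality in terms of all the functionals -/

theorem solutionFunctional_X_pow_mul_eq_zero {r : ℕ} {α : ℕ → K} {n : ℕ} {f : K[X]}
    (h : ∀ m < n, solutionFunctional r α (m + 1) f = 0) (k m : ℕ) (hm : r * k + m < n) :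
    solutionFunctional r α (m + 1) (X ^ k * f) = 0 := by
  induction k generalizing m with
  | zero => simpa using h m (by omega)
  | succ k ih =>
    rw [pow_succ', mul_assoc, solutionFunctional_X_mul]
    refine Finset.sum_eq_zero fun i hi => ?_
    rw [Finset.mem_range] at hi
    rw [ih (i + r) (by rw [mul_add] at hm; omega), mul_zero]

theorem solutionFunctional_X_pow_mul_ne_zero {r : ℕ} {α : ℕ → K} (hα : ∀ k, α k ≠ 0) {n : ℕ}
    {f : K[X]} (h : ∀ m < n, solutionFunctional r α (m + 1) f = 0)
    (hn : solutionFunctional r α (n + 1) f ≠ 0) (k m : ℕ) (hm : n = r * k + m) :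
    solutionFunctional r α (m + 1) (X ^ k * f) ≠ 0 := by
  induction k generalizing m with
  | zero =>
    obtain rfl : n = m := by simpa using hm
    simpa using hn
  | succ k ih =>
    rw [mul_add] at hm
    rw [pow_succ', mul_assoc, solutionFunctional_X_mul, Finset.sum_range_succ,
      Finset.sum_eq_zero, zero_add]
    -- Only the top term i = m survives in the sum.
    · exact mul_ne_zero (hα m) (ih (m + r) (by omega))
    · intro i hi
      rw [Finset.mem_range] at hi
      rw [solutionFunctional_X_pow_mul_eq_zero h k (i + r) (by omega), mul_zero]

theorem isROrthogonal_orthoPoly {r : ℕ} {α : ℕ → K} (hα : ∀ k, α k ≠ 0) :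
    IsROrthogonal r (fun i => solutionFunctional r α ((i : ℕ) + 1))
      (fun n => orthoPoly r α n 0) := by
  have hz : ∀ n, ∀ m < n, solutionFunctional r α (m + 1) (orthoPoly r α n 0) = 0 := by
    intro n m hm
    simpa using solutionFunctional_orthoPoly_eq_zero r α 0 hm
  have hn : ∀ n, solutionFunctional r α (n + 1) (orthoPoly r α n 0) ≠ 0 := by
    intro n
    have e := solutionFunctional_orthoPoly r α n 0
    rw [zero_add] at e
    rw [e]
    exact Finset.prod_ne_zero_iff.2 fun i _ => hα _
  exact ⟨fun n => monic_orthoPoly .., fun n => natDegree_orthoPoly ..,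
    fun i k n h => solutionFunctional_X_pow_mul_ne_zero hα (hz n) (hn n) k i h,
    fun i k n h => solutionFunctional_X_pow_mul_eq_zero (hz n) k i h⟩

/-- Orthogonality covers only u_1, …, u_r. Later functionals are recovered from α_i u_{i+r+1}(f) =
(u_{i+1} - u_i)(X f), trading r in the index for one power of X. -/
theorem IsROrthogonal.solutionFunctional_eq_zero {r : ℕ} (hr : 1 ≤ r) {α : ℕ → K} (hα : ∀ k, α k ≠ 0)
    {P : ℕ → K[X]}
    (hP : IsROrthogonal r (fun i => solutionFunctional r α ((i : ℕ) + 1)) P) (n m k : ℕ)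
    (h : r * k + m < n) : solutionFunctional r α (m + 1) (X ^ k * P n) = 0 := by
  induction m using Nat.strong_induction_on generalizing k with
  | _ m ih =>
    rcases lt_or_ge m r with hm | hm
    · exact hP.eq_zero ⟨m, hm⟩ k n h
    · obtain ⟨i, rfl⟩ := Nat.exists_eq_add_of_le' hm
      have e : solutionFunctional r α (i + 1) (X * (X ^ k * P n)) =
          solutionFunctional r α i (X * (X ^ k * P n)) +
            α i * solutionFunctional r α (i + r + 1) (X ^ k * P n) := by
        rw [solutionFunctional_X_mul, solutionFunctional_X_mul, Finset.sum_range_succ]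
      have hs : r * (k + 1) = r * k + r := by ring
      rw [← mul_assoc, ← pow_succ', ih i (by omega) (k + 1) (by omega)] at e
      have hi : solutionFunctional r α i (X ^ (k + 1) * P n) = 0 := by
        cases i with
        | zero => rw [pow_succ', mul_assoc, solutionFunctional_X_mul, Finset.sum_range_zero]
        | succ i => exact ih i (by omega) (k + 1) (by omega)
      rw [hi, zero_add, eq_comm, mul_eq_zero] at e
      exact e.resolve_left (hα i)

theorem isROrthogonal_iff {r : ℕ} (hr : 1 ≤ r) {α : ℕ → K} (hα : ∀ k, α k ≠ 0) {P : ℕ → K[X]} :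
    IsROrthogonal r (fun i => solutionFunctional r α ((i : ℕ) + 1)) P ↔
      P = fun n => orthoPoly r α n 0 := by
  constructor
  · intro hP
    funext n
    refine sub_eq_zero.1 (eq_zero_of_solutionFunctional_eq_zero (r := r) hα 0
      (degree_sub_lt_of_monic (hP.monic n) (monic_orthoPoly ..) (hP.natDegree_eq n)
        (natDegree_orthoPoly ..)) fun m hm => ?_)
    rw [map_sub, solutionFunctional_orthoPoly_eq_zero r α 0 hm, sub_zero, zero_add]
    simpa using hP.solutionFunctional_eq_zero hr hα n m 0 (by simpa using hm)
  · rintro rfl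
    exact isROrthogonal_orthoPoly hα

end MOP

theorem mainTheorem2 (r : ℕ) (hr : 1 ≤ r) (α : ℕ → ℂ) (hα : ∀ k, α k ≠ 0) :
    (∀ P : ℕ → Polynomial ℂ, P 0 = 1 →
      ((∀ n, Polynomial.X * P n = (MOP.hessenberg r α).mulVec P n) ↔
        ∃ v : Fin r → (Polynomial ℂ →ₗ[ℂ] ℂ),
          MOP.IsROrthogonal r v P ∧ (∀ i, v i 1 = 1) ∧
            ∃ g : ℕ → PowerSeries ℂ, MOP.IsSeriesSolution r α g ∧ MOP.GeneratesMoments r v g)) ∧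
    (∃! g : ℕ → PowerSeries ℂ, MOP.IsSeriesSolution r α g) ∧
    (∃! v : Fin r → (Polynomial ℂ →ₗ[ℂ] ℂ),
      (∀ i, v i 1 = 1) ∧
        ∃ g : ℕ → PowerSeries ℂ, MOP.IsSeriesSolution r α g ∧ MOP.GeneratesMoments r v g) := by
  -- Both `g` and `v` become explicit, which settles existence and uniqueness.
  simp only [MOP.isSeriesSolution_iff, exists_eq_left, MOP.generatesMoments_iff]
  refine ⟨fun P hP => ?_, ⟨_, rfl, fun _ h => h⟩,
    ⟨fun i => MOP.solutionFunctional r α ((i : ℕ) + 1),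
      ⟨fun i => MOP.solutionFunctional_one .., rfl⟩, fun _ h => h.2⟩⟩
  rw [MOP.hessenberg_recurrence_iff hα hP, ← MOP.isROrthogonal_iff hr hα]
  constructor
  · exact fun h => ⟨_, h, fun i => MOP.solutionFunctional_one .., rfl⟩
  · rintro ⟨_, h, -, rfl⟩
    exact h
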